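/- Let $n\ge 0$ and let $S_n$ be the symmetric group on $[n]=\{1,\dots,n\}$. The odd diagram of $w\in S_n$ is $$D_o(w)=\{(i,j)\in[n]\times[n] : w(i)>j,\ i<w^{-1}(j),\ i\not\equiv w^{-1}(j)\pmod 2\}.$$ Let $\ell(w)$ be the Coxeter length of $w$, that is, the least $k$ such that $w$ is a product of $k$ simple transpositions $(i\ \,i{+}1)$, and let $\le$ be the Bruhat order on $S_n$, the reflexive and transitive closure of the relations $w<w\,(i\ j)$ with $i<j$ and $\ell(w)<\ell(w\,(i\ j))$. For $u\le v$ put $[u,v]=\{w\in S_n: u\le w\le v\}$ and $$P_{u,v}(t)=t^{-\ell(u)}\sum_{u\le w\le v}t^{\ell(w)}.$$ Theorem. Let $D=D_o(w_0)$ for some $w_0\in S_n$. Then there are $u\le v$ in $S_n$ such that $$\{w\in S_n: D_o(w)=D\}=[u,v],$$ and the Poincaré polynomial $P_{u,v}(t)$ is a (possibly empty) finite product of polynomials of the form $1+t+\cdots+t^m$, $m\ge 0$. In particular, $P_{u,v}$ is palindromic, i.e. $t^dP_{u,v}(t^{-1})=P_{u,v}(t)$ where $d=\deg P_{u,v}$,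 and $[u,v]$ is rank-symmetric: for every integer $k\ge 0$, $$\#\{w\in[u,v]:\ell(w)-\ell(u)=k\}=\#\{w\in[u,v]:\ell(v)-\ell(w)=k\}.$$ -/

import Mathlib

open Polynomial

/-! Permutations of `[n]` are `Equiv.Perm (Fin n)`, with positions and values numbered from `0`
instead of `1`; this shift changes neither comparisons nor congruences modulo `2`. -/

namespace OddDiagram

variable {n : ℕ}

/-- The odd diagram `D_o(w) = {(i, j) : w(i) > j, i < w⁻¹(j), i ≢ w⁻¹(j) mod 2}`. -/
def oddDiagram (w : Equiv.Perm (Fin n)) : Set (Fin n × Fin n) :=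
  {p | p.2 < w p.1 ∧ p.1 < w⁻¹ p.2 ∧ ¬ (p.1 : ℕ) ≡ (w⁻¹ p.2 : ℕ) [MOD 2]}

/-- A set of boxes is an odd diagram if it is the odd diagram of some permutation. -/
def IsOddDiagram (D : Set (Fin n × Fin n)) : Prop :=
  ∃ w : Equiv.Perm (Fin n), oddDiagram w = D

/-- The class `Perm(D)` of all permutations with odd diagram `D`. -/
def permClass (D : Set (Fin n × Fin n)) : Set (Equiv.Perm (Fin n)) :=
  {w | oddDiagram w = D}

/-- `s` is a simple transposition `(i i+1)`. -/
def IsSimpleTransposition (s : Equiv.Perm (Fin n)) : Prop :=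
  ∃ i j : Fin n, (j : ℕ) = i + 1 ∧ s = Equiv.swap i j

/-- The Coxeter length `ℓ(w)`: the least `k` such that `w` is a product of `k` simple
transpositions. -/
noncomputable def length (w : Equiv.Perm (Fin n)) : ℕ :=
  sInf {k | ∃ l : List (Equiv.Perm (Fin n)),
    l.length = k ∧ (∀ s ∈ l, IsSimpleTransposition s) ∧ l.prod = w}

/-- The minimum in the definition of the length is taken over a nonempty set. -/
theorem exists_simple_word (w : Equiv.Perm (Fin n)) :
    ∃ l : List (Equiv.Perm (Fin n)), (∀ s ∈ l, IsSimpleTransposition s) ∧ l.prod = w := by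
  cases n with
  | zero => exact ⟨[], by simp, Subsingleton.elim _ _⟩
  | succ m =>
    have hw : w ∈ Submonoid.closure
        (Set.range fun i : Fin m => Equiv.swap i.castSucc i.succ) := by
      rw [Equiv.Perm.mclosure_swap_castSucc_succ]; trivial
    obtain ⟨l, hl, rfl⟩ := Submonoid.exists_list_of_mem_closure hw
    refine ⟨l, fun s hs => ?_, rfl⟩
    obtain ⟨i, rfl⟩ := hl s hs
    exact ⟨i.castSucc, i.succ, by simp, rfl⟩

/-- A generating relation `w < w (i j)` of the Bruhat order: `i < j` and `ℓ(w) < ℓ(w (i j))`. -/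
def BruhatStep (w w' : Equiv.Perm (Fin n)) : Prop :=
  ∃ i j : Fin n, i < j ∧ w' = w * Equiv.swap i j ∧ length w < length w'

/-- The Bruhat order `u ≤ v`. -/
def BruhatLE (u v : Equiv.Perm (Fin n)) : Prop :=
  Relation.ReflTransGen BruhatStep u v

/-- The Bruhat interval `[u, v]`. -/
def bruhatInterval (u v : Equiv.Perm (Fin n)) : Set (Equiv.Perm (Fin n)) :=
  {w | BruhatLE u w ∧ BruhatLE w v}

open Classical in
/-- The Poincaré polynomial `P_{u,v}(t) = t^{-ℓ(u)} ∑_{u ≤ w ≤ v} t^{ℓ(w)}`. The subtraction of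
natural numbers never truncates, see `toLaurent_poincare`. -/
noncomputable def poincare (u v : Equiv.Perm (Fin n)) : ℤ[X] :=
  ∑ w : Equiv.Perm (Fin n) with w ∈ bruhatInterval u v, X ^ (length w - length u)

theorem BruhatLE.length_le {u v : Equiv.Perm (Fin n)} (h : BruhatLE u v) :
    length u ≤ length v := by
  induction h with
  | refl => exact le_rfl
  | tail _ h ih =>
    obtain ⟨i, j, _, _, hlt⟩ := h
    exact ih.trans hlt.le

open Classical in
/-- The Poincaré polynomial, read as a Laurent polynomial, is literally
`t^{-ℓ(u)} ∑_{u ≤ w ≤ v} t^{ℓ(w)}`. -/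
theorem toLaurent_poincare (u v : Equiv.Perm (Fin n)) :
    toLaurent (poincare u v) = LaurentPolynomial.T (-(length u : ℤ)) *
      ∑ w : Equiv.Perm (Fin n) with w ∈ bruhatInterval u v,
        (LaurentPolynomial.T (length w : ℤ) : LaurentPolynomial ℤ) := by
  rw [poincare, map_sum, Finset.mul_sum]
  refine Finset.sum_congr rfl fun w hw => ?_
  have h : length u ≤ length w := ((Finset.mem_filter.1 hw).2.1).length_le
  rw [toLaurent_X_pow, ← LaurentPolynomial.T_add]
  congr 1
  omega

/-- A polynomial `f` of degree `d` is palindromic if `t^d f(t⁻¹) = f(t)`; the left side is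
`Polynomial.reverse`. -/
def IsPalindromic (f : ℤ[X]) : Prop :=
  f.reverse = f

/-- The Bruhat interval `[u, v]`, in which `w` has rank `ℓ(w) - ℓ(u)`, is rank-symmetric: for
every `k` it has as many elements of rank `k` as of rank `ℓ(v) - ℓ(u) - k`. -/
def IsRankSymmetric (u v : Equiv.Perm (Fin n)) : Prop :=
  ∀ k : ℕ, {w ∈ bruhatInterval u v | length w = length u + k}.ncard =
    {w ∈ bruhatInterval u v | length w + k = length v}.ncard

end OddDiagram

/-! Two entries at positions of equal parity can be exchanged without changing the odd diagram
exactly when no entry at a position of the other parity obstructs (`Clear`). If two members of the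
class agree before position `k` and differ at `k`, each can be given the other's value at `k` by
such an exchange (`exchange_down`, `exchange_up`). Hence, among the members with a given prefix,
multiplying on the left by a transposition of values is a bijection between the fibres over two
values at `k`, and it changes the length by exactly one if these values are consecutive among those
attained. Iterating over `k` yields a least member `u` and a greatest member `v`, joined to all
others by length-increasing exchanges, and one factor `1 + t + ... + t^m` per position.

It remains to see that `[u, v]` contains nothing else. Exchanges in the two parities commute, so a
rectangle spanned by an exchangeable pair of one member (`IsSwapBox`) stays clear in every member
(`clear_of_oddDiagram_eq`). Rank counts are monotone in the Bruhat order, and those of `u` and `v`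
agree off these rectangles, which forces the rank counts of every `x` in `[u, v]` there. By
`apply_ne_and_box_iff` this already determines the odd diagram of `x`. -/

namespace OddDiagram

variable {n : ℕ}

/-! ### Length as inversion number, and Bruhat steps. -/

/-- The number of inversions of a permutation. -/
def invCount (w : Equiv.Perm (Fin n)) : ℕ :=
  ∑ p, ∑ q, if p < q ∧ w q < w p then 1 else 0

theorem sum_univ_pair {i j : Fin n} (hij : i ≠ j) (f : Fin n → ℕ) :
    ∑ k, f k = f i + f j + ∑ k ∈ (Finset.univ.erase i).erase j, f k := by
  rw [← Finset.add_sum_erase _ f (Finset.mem_univ i),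
    ← Finset.add_sum_erase _ f (Finset.mem_erase.2 ⟨hij.symm, Finset.mem_univ j⟩)]
  ring

theorem sum_sum_univ_pair {i j : Fin n} (hij : i ≠ j) (f : Fin n → Fin n → ℕ) :
    ∑ p, ∑ q, f p q = f i i + f i j + f j i + f j j
      + ∑ k ∈ (Finset.univ.erase i).erase j, (f i k + f k i + f j k + f k j)
      + ∑ p ∈ (Finset.univ.erase i).erase j, ∑ q ∈ (Finset.univ.erase i).erase j, f p q := by
  rw [sum_univ_pair hij]
  simp only [sum_univ_pair hij (f _), Finset.sum_add_distrib]
  ring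

theorem invCount_mul_swap (w : Equiv.Perm (Fin n)) {i j : Fin n} (hij : i < j) (h : w i < w j) :
    invCount (w * Equiv.swap i j) = invCount w + 1 +
      2 * (Finset.univ.filter fun k => i < k ∧ k < j ∧ w i < w k ∧ w k < w j).card := by
  have hs : ∀ k ∈ (Finset.univ.erase i).erase j, k ≠ i ∧ k ≠ j ∧ Equiv.swap i j k = k := by
    intro k hk
    simp only [Finset.mem_erase, Finset.mem_univ, and_true] at hk
    exact ⟨hk.2, hk.1, Equiv.swap_apply_of_ne_of_ne hk.2 hk.1⟩
  rw [invCount, invCount, sum_sum_univ_pair hij.ne, sum_sum_univ_pair hij.ne, Finset.card_filter,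
    sum_univ_pair hij.ne]
  have h1 : ∑ p ∈ (Finset.univ.erase i).erase j, ∑ q ∈ (Finset.univ.erase i).erase j,
        (if p < q ∧ (w * Equiv.swap i j) q < (w * Equiv.swap i j) p then 1 else 0)
      = ∑ p ∈ (Finset.univ.erase i).erase j, ∑ q ∈ (Finset.univ.erase i).erase j,
        (if p < q ∧ w q < w p then 1 else 0) := by
    refine Finset.sum_congr rfl fun p hp => Finset.sum_congr rfl fun q hq => ?_
    simp only [Equiv.Perm.mul_apply, (hs p hp).2.2, (hs q hq).2.2]
  rw [h1]
  have h2 : ∑ k ∈ (Finset.univ.erase i).erase j,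
        ((if i < k ∧ (w * Equiv.swap i j) k < (w * Equiv.swap i j) i then 1 else 0)
        + (if k < i ∧ (w * Equiv.swap i j) i < (w * Equiv.swap i j) k then 1 else 0)
        + (if j < k ∧ (w * Equiv.swap i j) k < (w * Equiv.swap i j) j then 1 else 0)
        + (if k < j ∧ (w * Equiv.swap i j) j < (w * Equiv.swap i j) k then 1 else 0))
      = ∑ k ∈ (Finset.univ.erase i).erase j,
        ((if i < k ∧ w k < w i then 1 else 0) + (if k < i ∧ w i < w k then 1 else 0)
        + (if j < k ∧ w k < w j then 1 else 0) + (if k < j ∧ w j < w k then 1 else 0))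
      + 2 * ∑ k ∈ (Finset.univ.erase i).erase j,
        (if i < k ∧ k < j ∧ w i < w k ∧ w k < w j then 1 else 0) := by
    rw [Finset.mul_sum, ← Finset.sum_add_distrib]
    refine Finset.sum_congr rfl fun k hk => ?_
    obtain ⟨hki, hkj, hk'⟩ := hs k hk
    have hwi : w k ≠ w i := fun e => hki (w.injective e)
    have hwj : w k ≠ w j := fun e => hkj (w.injective e)
    simp only [Equiv.Perm.mul_apply, hk', Equiv.swap_apply_left, Equiv.swap_apply_right]
    split_ifs <;> omega
  rw [h2]
  simp only [Equiv.Perm.mul_apply, Equiv.swap_apply_left, Equiv.swap_apply_right, lt_irrefl,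
    false_and, and_false, if_false, hij, h, h.not_gt, hij.not_gt, true_and, if_true]
  ring

theorem invCount_lt_mul_swap (w : Equiv.Perm (Fin n)) {i j : Fin n} (hij : i < j)
    (h : w i < w j) : invCount w < invCount (w * Equiv.swap i j) := by
  rw [invCount_mul_swap w hij h]; omega

theorem invCount_mul_swap_of_forall (w : Equiv.Perm (Fin n)) {i j : Fin n} (hij : i < j)
    (h : w i < w j) (hno : ∀ k, i < k → k < j → w i < w k → ¬ w k < w j) :
    invCount (w * Equiv.swap i j) = invCount w + 1 := by
  rw [invCount_mul_swap w hij h, Finset.filter_false_of_mem]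
  · simp
  · rintro k - ⟨h1, h2, h3, h4⟩
    exact hno k h1 h2 h3 h4

theorem invCount_mul_adjacent (w : Equiv.Perm (Fin n)) {i j : Fin n} (hij : (j : ℕ) = i + 1)
    (h : w i < w j) : invCount (w * Equiv.swap i j) = invCount w + 1 :=
  invCount_mul_swap_of_forall w (Fin.lt_def.2 (by omega)) h fun k h1 h2 => by
    rw [Fin.lt_def] at h1 h2; omega

theorem invCount_mul_adjacent_of_gt (w : Equiv.Perm (Fin n)) {i j : Fin n} (hij : (j : ℕ) = i + 1)
    (h : w j < w i) : invCount (w * Equiv.swap i j) + 1 = invCount w := by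
  have := invCount_mul_adjacent (w * Equiv.swap i j) hij (by simpa using h)
  rw [mul_assoc, Equiv.swap_mul_self, mul_one] at this
  exact this.symm

theorem invCount_one : invCount (1 : Equiv.Perm (Fin n)) = 0 := by
  refine Finset.sum_eq_zero fun p _ => Finset.sum_eq_zero fun q _ => if_neg ?_
  rintro ⟨h1, h2⟩
  exact h1.not_gt h2

theorem invCount_prod_le (l : List (Equiv.Perm (Fin n)))
    (hl : ∀ s ∈ l, IsSimpleTransposition s) : invCount l.prod ≤ l.length := by
  induction l using List.reverseRecOn with
  | nil => simp [invCount_one]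
  | append_singleton l s ih =>
    have ih' := ih fun t ht => hl t (by simp [ht])
    obtain ⟨i, j, hij, rfl⟩ := hl s (by simp)
    rw [List.prod_append, List.prod_singleton, List.length_append, List.length_singleton]
    rcases lt_trichotomy (l.prod i) (l.prod j) with h | h | h
    · rw [invCount_mul_adjacent _ hij h]; omega
    · have := congrArg Fin.val (l.prod.injective h); omega
    · have := invCount_mul_adjacent_of_gt _ hij h; omega

theorem eq_one_of_no_descent (w : Equiv.Perm (Fin n))
    (h : ∀ i j : Fin n, (j : ℕ) = i + 1 → w i < w j) : w = 1 := by
  have hm : StrictMono w := by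
    cases n with
    | zero => exact fun a => a.elim0
    | succ m => exact Fin.strictMono_iff_lt_succ.2 fun i => h _ _ (by simp)
  have : (hm.orderIsoOfSurjective w w.surjective) = OrderIso.refl _ := Subsingleton.elim _ _
  ext x
  exact congrArg Fin.val (DFunLike.congr_fun this x)

theorem exists_word_invCount (w : Equiv.Perm (Fin n)) :
    ∃ l : List (Equiv.Perm (Fin n)),
      l.length = invCount w ∧ (∀ s ∈ l, IsSimpleTransposition s) ∧ l.prod = w := by
  induction hk : invCount w using Nat.strong_induction_on generalizing w with
  | _ k ih =>
    by_cases h : ∀ i j : Fin n, (j : ℕ) = i + 1 → w i < w j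
    · obtain rfl := eq_one_of_no_descent w h
      exact ⟨[], by rw [← hk, invCount_one]; rfl, by simp, rfl⟩
    · push Not at h
      obtain ⟨i, j, hij, hle⟩ := h
      have hlt : w j < w i := lt_of_le_of_ne hle fun e => by
        have := congrArg Fin.val (w.injective e); omega
      have hinv := invCount_mul_adjacent_of_gt w hij hlt
      obtain ⟨l, hl, hs, hp⟩ := ih _ (by omega) (w * Equiv.swap i j) rfl
      refine ⟨l ++ [Equiv.swap i j], ?_, ?_, ?_⟩
      · rw [List.length_append, hl, List.length_singleton]; omega
      · intro s hs'
        rcases List.mem_append.1 hs' with h' | h'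
        · exact hs s h'
        · exact ⟨i, j, hij, by simpa using h'⟩
      · rw [List.prod_append, hp, List.prod_singleton, mul_assoc, Equiv.swap_mul_self, mul_one]

theorem length_eq_invCount (w : Equiv.Perm (Fin n)) : length w = invCount w := by
  refine le_antisymm (Nat.sInf_le (exists_word_invCount w)) ?_
  refine le_csInf ⟨_, exists_word_invCount w⟩ ?_
  rintro k ⟨l, rfl, hl, rfl⟩
  exact invCount_prod_le l hl

theorem bruhatStep_mul_swap (w : Equiv.Perm (Fin n)) {i j : Fin n} (hij : i < j)
    (h : w i < w j) : BruhatStep w (w * Equiv.swap i j) :=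
  ⟨i, j, hij, rfl, by simpa only [length_eq_invCount] using invCount_lt_mul_swap w hij h⟩

theorem BruhatStep.exists_lt {w w' : Equiv.Perm (Fin n)} (h : BruhatStep w w') :
    ∃ i j, i < j ∧ w i < w j ∧ w' = w * Equiv.swap i j := by
  obtain ⟨i, j, hij, rfl, hl⟩ := h
  refine ⟨i, j, hij, ?_, rfl⟩
  by_contra hc
  have hlt : w j < w i := lt_of_le_of_ne (not_lt.1 hc) fun e => hij.ne' (w.injective e)
  have := invCount_lt_mul_swap (w * Equiv.swap i j) hij (by simpa using hlt)
  rw [mul_assoc, Equiv.swap_mul_self, mul_one] at this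
  simp only [length_eq_invCount] at hl
  omega

/-! ### Rank counts and their monotonicity. -/

/-- The number of positions before `k` with value at least `b`. -/
def rankCount (w : Equiv.Perm (Fin n)) (k b : ℕ) : ℕ :=
  ∑ l : Fin n, if (l : ℕ) < k ∧ b ≤ w l then 1 else 0

theorem rankCount_mul_swap (w : Equiv.Perm (Fin n)) {i j : Fin n} (hij : i < j) (h : w i < w j)
    (k b : ℕ) : rankCount (w * Equiv.swap i j) k b = rankCount w k b +
      if (i : ℕ) < k ∧ k ≤ j ∧ (w i : ℕ) < b ∧ b ≤ w j then 1 else 0 := by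
  rw [rankCount, rankCount, sum_univ_pair hij.ne, sum_univ_pair hij.ne]
  have hrest : ∑ l ∈ (Finset.univ.erase i).erase j,
      (if (l : ℕ) < k ∧ b ≤ (w * Equiv.swap i j) l then 1 else 0)
      = ∑ l ∈ (Finset.univ.erase i).erase j, (if (l : ℕ) < k ∧ b ≤ w l then 1 else 0) := by
    refine Finset.sum_congr rfl fun l hl => ?_
    simp only [Finset.mem_erase, Finset.mem_univ, and_true] at hl
    rw [Equiv.Perm.mul_apply, Equiv.swap_apply_of_ne_of_ne hl.2 hl.1]
  rw [hrest]
  simp only [Equiv.Perm.mul_apply, Equiv.swap_apply_left, Equiv.swap_apply_right]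
  rw [Fin.lt_def] at hij h
  split_ifs <;> omega

/-- Only this easy half of the rank criterion for the Bruhat order is needed. -/
theorem BruhatLE.rankCount_le {u v : Equiv.Perm (Fin n)} (h : BruhatLE u v) (k b : ℕ) :
    rankCount u k b ≤ rankCount v k b := by
  induction h with
  | refl => exact le_rfl
  | tail _ h ih =>
    obtain ⟨i, j, hij, hw, rfl⟩ := h.exists_lt
    rw [rankCount_mul_swap _ hij hw]
    omega

theorem rankCount_succ_left (w : Equiv.Perm (Fin n)) (k : Fin n) (b : ℕ) :
    rankCount w (k + 1) b = rankCount w k b + if b ≤ w k then 1 else 0 := by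
  rw [rankCount, rankCount, ← Finset.add_sum_erase _ _ (Finset.mem_univ k),
    ← Finset.add_sum_erase (a := k) _ _ (Finset.mem_univ k)]
  have : ∑ l ∈ Finset.univ.erase k, (if (l : ℕ) < k + 1 ∧ b ≤ w l then 1 else 0)
      = ∑ l ∈ Finset.univ.erase k, (if (l : ℕ) < k ∧ b ≤ w l then 1 else 0) := by
    refine Finset.sum_congr rfl fun l hl => ?_
    have : (l : ℕ) ≠ k := fun e => (Finset.mem_erase.1 hl).1 (Fin.ext e)
    split_ifs <;> omega
  rw [this]
  split_ifs <;> omega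

theorem rankCount_succ_right (w : Equiv.Perm (Fin n)) (k : ℕ) (b : Fin n) :
    rankCount w k b = rankCount w k (b + 1) + if (w⁻¹ b : ℕ) < k then 1 else 0 := by
  rw [rankCount, rankCount, ← Finset.add_sum_erase _ _ (Finset.mem_univ (w⁻¹ b)),
    ← Finset.add_sum_erase (a := w⁻¹ b) _ _ (Finset.mem_univ (w⁻¹ b))]
  have : ∑ l ∈ Finset.univ.erase (w⁻¹ b), (if (l : ℕ) < k ∧ (b : ℕ) ≤ w l then 1 else 0)
      = ∑ l ∈ Finset.univ.erase (w⁻¹ b), (if (l : ℕ) < k ∧ (b : ℕ) + 1 ≤ w l then 1 else 0) := by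
    refine Finset.sum_congr rfl fun l hl => ?_
    have : (w l : ℕ) ≠ b := fun e => (Finset.mem_erase.1 hl).1 (by
      rw [Equiv.Perm.eq_inv_iff_eq]; exact Fin.ext e)
    split_ifs <;> omega
  rw [this]
  rw [show w (w⁻¹ b) = b from w.apply_symm_apply b]
  split_ifs <;> omega

/-! ### Exchanges that preserve the odd diagram. -/

theorem mem_oddDiagram (w : Equiv.Perm (Fin n)) (p b : Fin n) :
    (p, b) ∈ oddDiagram w ↔ b < w p ∧ p < w⁻¹ b ∧ (p : ℕ) % 2 ≠ (w⁻¹ b : ℕ) % 2 := Iff.rfl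

theorem mem_oddDiagram_apply (w : Equiv.Perm (Fin n)) (p m : Fin n) :
    (p, w m) ∈ oddDiagram w ↔ w m < w p ∧ p < m ∧ (p : ℕ) % 2 ≠ (m : ℕ) % 2 := by
  rw [mem_oddDiagram, show w⁻¹ (w m) = m from w.symm_apply_apply m]

/-- A point `(q, w q)` with `q` of the parity opposite to `i` lies to the left of, below, or
strictly north-east of the box `[i, j] × [lo, hi]`. -/
def Clear (i j lo hi : ℕ) (w : Equiv.Perm (Fin n)) : Prop :=
  ∀ q : Fin n, (q : ℕ) % 2 ≠ i % 2 → i < q → lo < w q → j < q ∧ hi < w q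

theorem oddDiagram_mul_swap_of_clear {w : Equiv.Perm (Fin n)} {i j : Fin n} (hij : i < j)
    (hpar : (i : ℕ) % 2 = (j : ℕ) % 2) (h : w i < w j) (hc : Clear i j (w i) (w j) w) :
    oddDiagram (w * Equiv.swap i j) = oddDiagram w := by
  ext ⟨p, b⟩
  obtain ⟨m, rfl⟩ := w.surjective b
  -- The column is named by the position of its value: `m` in `w`, `swap i j m` after the exchange.
  have hm : w m = (w * Equiv.swap i j) (Equiv.swap i j m) := by simp
  rw [mem_oddDiagram_apply, hm, mem_oddDiagram_apply, ← hm, Equiv.Perm.mul_apply]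
  have hcp := hc p
  have hcm := hc m
  rw [Fin.lt_def] at hij h
  by_cases hpi : p = i
  · subst hpi
    rw [Equiv.swap_apply_left]
    by_cases hmi : m = p
    · subst hmi; simp [hpar]
    by_cases hmj : m = j
    · subst hmj; simp [hpar]
    rw [Equiv.swap_apply_of_ne_of_ne hmi hmj]
    have : (w m : ℕ) ≠ w p := fun e => hmi (w.injective (Fin.ext e))
    simp only [Fin.lt_def]
    omega
  by_cases hpj : p = j
  · subst hpj
    rw [Equiv.swap_apply_right]
    by_cases hmi : m = i
    · subst hmi; simp [hpar]
    by_cases hmj : m = p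
    · subst hmj; simp [hpar]
    rw [Equiv.swap_apply_of_ne_of_ne hmi hmj]
    have : (w m : ℕ) ≠ w i := fun e => hmi (w.injective (Fin.ext e))
    simp only [Fin.lt_def]
    omega
  rw [Equiv.swap_apply_of_ne_of_ne hpi hpj]
  by_cases hmi : m = i
  · subst hmi
    rw [Equiv.swap_apply_left]
    simp only [Fin.lt_def]
    omega
  by_cases hmj : m = j
  · subst hmj
    rw [Equiv.swap_apply_right]
    have : (p : ℕ) ≠ i := fun e => hpi (Fin.ext e)
    simp only [Fin.lt_def]
    omega
  rw [Equiv.swap_apply_of_ne_of_ne hmi hmj]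

/-- Two test boxes suffice: `(q, w i)` forces `j < q`, and `(i, w q)` forces `w j < w q`. -/
theorem clear_of_oddDiagram_mul_swap {w : Equiv.Perm (Fin n)} {i j : Fin n} (hij : i < j)
    (hpar : (i : ℕ) % 2 = (j : ℕ) % 2)
    (hD : oddDiagram (w * Equiv.swap i j) = oddDiagram w) : Clear i j (w i) (w j) w := by
  intro q hq hiq hlo
  have hqi : q ≠ i := by rintro rfl; exact hq rfl
  have hqj : q ≠ j := by rintro rfl; exact hq hpar.symm
  have hsq : (w * Equiv.swap i j) q = w q := by
    rw [Equiv.Perm.mul_apply, Equiv.swap_apply_of_ne_of_ne hqi hqj]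
  have hsi : (w * Equiv.swap i j) i = w j := by simp
  have hsj : (w * Equiv.swap i j) j = w i := by simp
  have h1 : (q, w i) ∈ oddDiagram (w * Equiv.swap i j) ↔ (q, w i) ∈ oddDiagram w := by rw [hD]
  rw [← hsj, mem_oddDiagram_apply, hsj, hsq, mem_oddDiagram_apply] at h1
  have h2 : (i, w q) ∈ oddDiagram (w * Equiv.swap i j) ↔ (i, w q) ∈ oddDiagram w := by rw [hD]
  rw [← hsq, mem_oddDiagram_apply, hsi, hsq, mem_oddDiagram_apply] at h2
  have hqj' : (q : ℕ) ≠ j := fun e => hqj (Fin.ext e)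
  have hwqj : (w q : ℕ) ≠ w j := fun e => hqj (w.injective (Fin.ext e))
  simp only [Fin.lt_def] at h1 h2
  omega

theorem oddDiagram_mul_swap_iff {w : Equiv.Perm (Fin n)} {i j : Fin n} (hij : i < j)
    (hpar : (i : ℕ) % 2 = (j : ℕ) % 2) (h : w i < w j) :
    oddDiagram (w * Equiv.swap i j) = oddDiagram w ↔ Clear i j (w i) (w j) w :=
  ⟨clear_of_oddDiagram_mul_swap hij hpar, oddDiagram_mul_swap_of_clear hij hpar h⟩

/-! ### Exchanges between two members of a class. -/

theorem inv_apply_eq_of_agree {w w' : Equiv.Perm (Fin n)} {k : ℕ}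
    (hag : ∀ l : Fin n, (l : ℕ) < k → w l = w' l) {b : Fin n} (h : (w⁻¹ b : ℕ) < k) :
    w'⁻¹ b = w⁻¹ b := by
  rw [Equiv.Perm.inv_eq_iff_eq, ← hag _ h]
  exact (w.apply_symm_apply b).symm

theorem le_inv_apply_of_agree {w w' : Equiv.Perm (Fin n)} {k : ℕ}
    (hag : ∀ l : Fin n, (l : ℕ) < k → w l = w' l) {b : Fin n} (h : k ≤ (w⁻¹ b : ℕ)) :
    k ≤ (w'⁻¹ b : ℕ) := by
  by_contra hc
  have := inv_apply_eq_of_agree (fun l hl => (hag l hl).symm) (not_le.1 hc)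
  rw [this] at h
  exact hc h

/-- Read off from `w`, row `k` of the diagram lies below the value `w k`, and column `w k` has boxes
only in rows before `k`. Both facts transfer to `w'`; the column gives the equal parity, and
together they give clearance. -/
theorem exchange_down {w w' : Equiv.Perm (Fin n)} (hD : oddDiagram w' = oddDiagram w) {k : Fin n}
    (hag : ∀ l : Fin n, (l : ℕ) < k → w l = w' l) (hlt : w k < w' k) :
    k < w'⁻¹ (w k) ∧ (k : ℕ) % 2 = (w'⁻¹ (w k) : ℕ) % 2 ∧
      oddDiagram (w' * Equiv.swap k (w'⁻¹ (w k))) = oddDiagram w := by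
  obtain ⟨p, hp⟩ := w'.surjective (w k)
  rw [← hp, show w'⁻¹ (w' p) = p from w'.symm_apply_apply p]
  have hkp : k < p := by
    have h1 : (k : ℕ) ≤ (w'⁻¹ (w k) : ℕ) :=
      le_inv_apply_of_agree hag (by rw [show w⁻¹ (w k) = k from w.symm_apply_apply k])
    rw [← hp, show w'⁻¹ (w' p) = p from w'.symm_apply_apply p] at h1
    refine lt_of_le_of_ne h1 ?_
    rintro rfl
    exact hlt.ne hp.symm
  have hrow : ∀ q, (k, w' q) ∈ oddDiagram w' → w' q < w k := fun q hq => by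
    rw [hD] at hq; exact hq.1
  have hcol : ∀ q, (q, w k) ∈ oddDiagram w' → q < k := fun q hq => by
    rw [hD, mem_oddDiagram_apply] at hq; exact hq.2.1
  have hpar : (k : ℕ) % 2 = (p : ℕ) % 2 := by
    by_contra hne
    have := hcol k (by rw [← hp, mem_oddDiagram_apply, hp]; exact ⟨hlt, hkp, hne⟩)
    exact lt_irrefl _ this
  refine ⟨hkp, hpar, ?_⟩
  rw [← hD]
  have hk1 : (w' * Equiv.swap k p) k = w' p := by simp
  have hp1 : (w' * Equiv.swap k p) p = w' k := by simp
  have key := oddDiagram_mul_swap_iff (w := w' * Equiv.swap k p) hkp hpar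
    (by rw [hk1, hp1, hp]; exact hlt)
  rw [mul_assoc, Equiv.swap_mul_self, mul_one] at key
  refine (key.2 ?_).symm
  rw [hk1, hp1]
  intro q hq hkq hlo
  have hqk : q ≠ k := by rintro rfl; exact hq rfl
  have hqp : q ≠ p := by rintro rfl; exact hq hpar.symm
  rw [Equiv.Perm.mul_apply, Equiv.swap_apply_of_ne_of_ne hqk hqp] at hlo ⊢
  have hwqk : (w' q : ℕ) ≠ w' k := fun e => hqk (w'.injective (Fin.ext e))
  have hqp' : (q : ℕ) ≠ p := fun e => hqp (Fin.ext e)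
  have h1 := hrow q
  have h2 := hcol q
  rw [← hp] at h1 h2
  rw [mem_oddDiagram_apply] at h1 h2
  simp only [Fin.lt_def] at h1 h2
  omega

/-- `exchange_down` makes the two permutations agree one position further, and it moves values only
between positions of equal parity. -/
theorem inv_mod_two_eq_of_agree (k : ℕ) (hk : k ≤ n) (w w' : Equiv.Perm (Fin n))
    (hD : oddDiagram w' = oddDiagram w) (hag : ∀ l : Fin n, (l : ℕ) < k → w l = w' l)
    (b : Fin n) : (w⁻¹ b : ℕ) % 2 = (w'⁻¹ b : ℕ) % 2 := by
  induction hk using Nat.decreasingInduction generalizing w w' with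
  | self =>
    obtain rfl : w = w' := Equiv.ext fun l => hag l l.2
    rfl
  | of_succ k hk ih =>
    have main : ∀ w w' : Equiv.Perm (Fin n), oddDiagram w' = oddDiagram w →
        (∀ l : Fin n, (l : ℕ) < k → w l = w' l) → w ⟨k, hk⟩ < w' ⟨k, hk⟩ →
        (w⁻¹ b : ℕ) % 2 = (w'⁻¹ b : ℕ) % 2 := by
      intro w w' hD hag hlt
      obtain ⟨hkp, hpar, hD'⟩ := exchange_down (k := ⟨k, hk⟩) hD hag hlt
      set p := w'⁻¹ (w ⟨k, hk⟩) with hp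
      have h1 := ih w (w' * Equiv.swap ⟨k, hk⟩ p) hD' (fun l hl => by
        rcases Nat.lt_succ_iff_lt_or_eq.1 hl with hl | hl
        · rw [Equiv.Perm.mul_apply, Equiv.swap_apply_of_ne_of_ne, hag l hl]
          · rintro rfl; simp at hl
          · rintro rfl; rw [Fin.lt_def] at hkp; simp at hkp; omega
        · obtain rfl : l = ⟨k, hk⟩ := Fin.ext hl
          rw [Equiv.Perm.mul_apply, Equiv.swap_apply_left, hp]
          exact (w'.apply_symm_apply _).symm)
      rw [h1, mul_inv_rev, Equiv.Perm.mul_apply, Equiv.swap_inv, Equiv.swap_apply_def]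
      split_ifs with h2 h3
      · rw [h2]; exact hpar.symm
      · rw [h3]; exact hpar
      · rfl
    rcases lt_trichotomy (w ⟨k, hk⟩) (w' ⟨k, hk⟩) with h | h | h
    · exact main w w' hD hag h
    · refine ih w w' hD fun l hl => ?_
      rcases Nat.lt_succ_iff_lt_or_eq.1 hl with hl | hl
      · exact hag l hl
      · obtain rfl : l = ⟨k, hk⟩ := Fin.ext hl
        exact h
    · exact (main w' w hD.symm (fun l hl => (hag l hl).symm) h).symm

/-- The parity of the position of each value is determined by the odd diagram. -/
theorem inv_mod_two_eq {w w' : Equiv.Perm (Fin n)} (hD : oddDiagram w' = oddDiagram w)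
    (b : Fin n) : (w⁻¹ b : ℕ) % 2 = (w'⁻¹ b : ℕ) % 2 :=
  inv_mod_two_eq_of_agree 0 (Nat.zero_le _) w w' hD (fun _ h => absurd h (Nat.not_lt_zero _)) b

/-- Unlike `exchange_down`, this needs `inv_mod_two_eq`: both the parity of the new position and
that of an obstructing value must be transported between `w` and `w'`. -/
theorem exchange_up {w w' : Equiv.Perm (Fin n)} (hD : oddDiagram w' = oddDiagram w) {k : Fin n}
    (hag : ∀ l : Fin n, (l : ℕ) < k → w l = w' l) (hlt : w k < w' k) :
    k < w⁻¹ (w' k) ∧ (k : ℕ) % 2 = (w⁻¹ (w' k) : ℕ) % 2 ∧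
      oddDiagram (w * Equiv.swap k (w⁻¹ (w' k))) = oddDiagram w := by
  obtain ⟨p, hp⟩ := w.surjective (w' k)
  have hcolor := inv_mod_two_eq hD
  have hpar := hcolor (w' k)
  rw [← hp, show w⁻¹ (w p) = p from w.symm_apply_apply p, hp,
    show w'⁻¹ (w' k) = k from w'.symm_apply_apply k] at hpar
  rw [← hp, show w⁻¹ (w p) = p from w.symm_apply_apply p]
  have hag' : ∀ l : Fin n, (l : ℕ) < k → w' l = w l := fun l hl => (hag l hl).symm
  have hkp : k < p := by
    have h1 : (k : ℕ) ≤ (w⁻¹ (w' k) : ℕ) :=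
      le_inv_apply_of_agree hag' (by rw [show w'⁻¹ (w' k) = k from w'.symm_apply_apply k])
    rw [← hp, show w⁻¹ (w p) = p from w.symm_apply_apply p] at h1
    refine lt_of_le_of_ne h1 ?_
    rintro rfl
    exact hlt.ne hp
  refine ⟨hkp, hpar.symm, (oddDiagram_mul_swap_iff hkp hpar.symm (by rwa [hp])).2 ?_⟩
  intro q hq hkq hlo
  obtain ⟨r, hr⟩ := w'.surjective (w q)
  have hqr := hcolor (w q)
  rw [show w⁻¹ (w q) = q from w.symm_apply_apply q, ← hr,
    show w'⁻¹ (w' r) = r from w'.symm_apply_apply r] at hqr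
  have hkr : (k : ℕ) ≤ r := by
    have h1 : (k : ℕ) ≤ (w'⁻¹ (w q) : ℕ) :=
      le_inv_apply_of_agree hag (by rw [show w⁻¹ (w q) = q from w.symm_apply_apply q]; exact hkq.le)
    rwa [← hr, show w'⁻¹ (w' r) = r from w'.symm_apply_apply r] at h1
  have h1 : (k, w' r) ∈ oddDiagram w' ↔ (k, w' r) ∈ oddDiagram w := by rw [hD]
  rw [mem_oddDiagram_apply, hr, mem_oddDiagram_apply, ← hp] at h1
  have h2 : (q, w p) ∈ oddDiagram w ↔ (q, w p) ∈ oddDiagram w' := by rw [hD]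
  rw [mem_oddDiagram_apply, hp, mem_oddDiagram_apply, ← hp] at h2
  have hqp : q ≠ p := by rintro rfl; exact hq hpar
  have hwqp : (w q : ℕ) ≠ w p := fun e => hqp (w.injective (Fin.ext e))
  have hqp' : (q : ℕ) ≠ p := fun e => hqp (Fin.ext e)
  simp only [Fin.lt_def] at h1 h2
  omega

/-! ### Prefix classes: extremal members and the product formula. -/

/-- An inversion-creating exchange of two values at positions of equal parity which preserves the
odd diagram. -/
def UpSwap (w w' : Equiv.Perm (Fin n)) : Prop :=
  oddDiagram w' = oddDiagram w ∧ ∃ i j : Fin n, i < j ∧ (i : ℕ) % 2 = (j : ℕ) % 2 ∧ w i < w j ∧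
    w' = w * Equiv.swap i j

theorem UpSwap.bruhatStep {w w' : Equiv.Perm (Fin n)} (h : UpSwap w w') : BruhatStep w w' := by
  obtain ⟨_, i, j, hij, _, hlt, rfl⟩ := h
  exact bruhatStep_mul_swap w hij hlt

open Classical in
/-- The permutations with the same odd diagram as `w₀` which agree with `w₀` before position `k`. -/
noncomputable def prefixClass (k : ℕ) (w₀ : Equiv.Perm (Fin n)) : Finset (Equiv.Perm (Fin n)) :=
  {w | oddDiagram w = oddDiagram w₀ ∧ ∀ l : Fin n, (l : ℕ) < k → w l = w₀ l}

theorem mem_prefixClass {k : ℕ} {w₀ w : Equiv.Perm (Fin n)} :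
    w ∈ prefixClass k w₀ ↔
      oddDiagram w = oddDiagram w₀ ∧ ∀ l : Fin n, (l : ℕ) < k → w l = w₀ l := by
  classical
  simp [prefixClass]

theorem self_mem_prefixClass (k : ℕ) (w₀ : Equiv.Perm (Fin n)) : w₀ ∈ prefixClass k w₀ :=
  mem_prefixClass.2 ⟨rfl, fun _ _ => rfl⟩

theorem prefixClass_succ_eq {k : Fin n} {w₀ w₁ : Equiv.Perm (Fin n)}
    (h₁ : w₁ ∈ prefixClass k w₀) :
    prefixClass (k + 1) w₁ = (prefixClass k w₀).filter fun w => w k = w₁ k := by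
  rw [mem_prefixClass] at h₁
  ext w
  rw [Finset.mem_filter, mem_prefixClass, mem_prefixClass, h₁.1, and_assoc]
  refine and_congr_right fun _ => ⟨fun h => ⟨fun l hl => ?_, h k (by simp)⟩, fun h l hl => ?_⟩
  · rw [h l (by omega), h₁.2 l hl]
  · rcases Nat.lt_succ_iff_lt_or_eq.1 hl with hl | hl
    · rw [h.1 l hl, h₁.2 l hl]
    · obtain rfl : l = k := Fin.ext hl
      exact h.2

theorem mul_swap_mem_prefixClass {k : Fin n} {w₀ w : Equiv.Perm (Fin n)}
    (h : w ∈ prefixClass k w₀) {p : Fin n} (hkp : k < p)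
    (hD : oddDiagram (w * Equiv.swap k p) = oddDiagram w) :
    w * Equiv.swap k p ∈ prefixClass k w₀ := by
  rw [mem_prefixClass] at h ⊢
  refine ⟨hD.trans h.1, fun l hl => ?_⟩
  rw [Equiv.Perm.mul_apply, Equiv.swap_apply_of_ne_of_ne, h.2 l hl]
  · rintro rfl; exact lt_irrefl _ hl
  · rintro rfl; exact absurd hkp (not_lt.2 (Fin.le_def.2 hl.le))

theorem prefixClass_agree {k : Fin n} {w₀ w w' : Equiv.Perm (Fin n)}
    (h : w ∈ prefixClass k w₀) (h' : w' ∈ prefixClass k w₀) :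
    oddDiagram w' = oddDiagram w ∧ ∀ l : Fin n, (l : ℕ) < k → w l = w' l := by
  rw [mem_prefixClass] at h h'
  exact ⟨h'.1.trans h.1.symm, fun l hl => (h.2 l hl).trans (h'.2 l hl).symm⟩

/-- Written on values, the exchanges up and down are the same left multiplication, independent of
positions; it therefore acts on whole fibres and is its own inverse. -/
theorem exists_upSwap_of_lt {k : Fin n} {w₀ w w' : Equiv.Perm (Fin n)}
    (h : w ∈ prefixClass k w₀) (h' : w' ∈ prefixClass k w₀) (hlt : w k < w' k) :
    UpSwap w (Equiv.swap (w k) (w' k) * w) ∧ Equiv.swap (w k) (w' k) * w ∈ prefixClass k w₀ ∧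
      UpSwap (Equiv.swap (w k) (w' k) * w') w' ∧
      Equiv.swap (w k) (w' k) * w' ∈ prefixClass k w₀ := by
  obtain ⟨hD, hag⟩ := prefixClass_agree h h'
  have hw : w (w⁻¹ (w' k)) = w' k := w.apply_symm_apply _
  have hw' : w' (w'⁻¹ (w k)) = w k := w'.apply_symm_apply _
  obtain ⟨h1, h2, h3⟩ := exchange_up hD hag hlt
  obtain ⟨h4, h5, h6⟩ := exchange_down hD hag hlt
  have e1 : Equiv.swap (w k) (w' k) * w = w * Equiv.swap k (w⁻¹ (w' k)) := by
    rw [Equiv.mul_swap_eq_swap_mul, hw]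
  have e2 : Equiv.swap (w k) (w' k) * w' = w' * Equiv.swap k (w'⁻¹ (w k)) := by
    rw [Equiv.mul_swap_eq_swap_mul, hw', Equiv.swap_comm]
  rw [e1, e2]
  refine ⟨⟨h3, _, _, h1, h2, by rwa [hw], rfl⟩, mul_swap_mem_prefixClass h h1 h3,
    ⟨hD.trans h6.symm, _, _, h4, h5, ?_, ?_⟩, mul_swap_mem_prefixClass h' h4 (h6.trans hD.symm)⟩
  · rwa [Equiv.Perm.mul_apply, Equiv.Perm.mul_apply, Equiv.swap_apply_left,
      Equiv.swap_apply_right, hw']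
  · rw [mul_assoc, Equiv.swap_mul_self, mul_one]

theorem prefixClass_eq_singleton (w₀ : Equiv.Perm (Fin n)) : prefixClass n w₀ = {w₀} := by
  ext w
  rw [mem_prefixClass, Finset.mem_singleton]
  refine ⟨fun h => Equiv.ext fun l => h.2 l l.2, ?_⟩
  rintro rfl
  exact ⟨rfl, fun _ _ => rfl⟩

theorem exists_greatest_prefixClass {k : ℕ} (hk : k ≤ n) (w₀ : Equiv.Perm (Fin n)) :
    ∃ v ∈ prefixClass k w₀, ∀ w ∈ prefixClass k w₀, Relation.ReflTransGen UpSwap w v := by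
  induction hk using Nat.decreasingInduction generalizing w₀ with
  | self => exact ⟨w₀, self_mem_prefixClass _ _, by simp [prefixClass_eq_singleton]; rfl⟩
  | of_succ k hk ih =>
    obtain ⟨w₁, h₁, hmax⟩ := Finset.exists_max_image (prefixClass k w₀) (fun w => w ⟨k, hk⟩)
      ⟨w₀, self_mem_prefixClass _ _⟩
    obtain ⟨v, hv, hvmax⟩ := ih w₁
    rw [prefixClass_succ_eq (k := ⟨k, hk⟩) h₁] at hv hvmax
    refine ⟨v, (Finset.mem_filter.1 hv).1, fun w hw => ?_⟩
    rcases (hmax w hw).eq_or_lt with he | hlt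
    · exact hvmax w (Finset.mem_filter.2 ⟨hw, he⟩)
    · obtain ⟨hs, hm, -⟩ := exists_upSwap_of_lt (k := ⟨k, hk⟩) hw h₁ hlt
      exact Relation.ReflTransGen.head hs (hvmax _ (Finset.mem_filter.2 ⟨hm, by simp⟩))

/-- An entry inside the exchanged rectangle would have the parity of `k` by clearance, and
exchanging it with position `k` would be allowed too, giving a member with an intermediate value at
`k`. -/
theorem invCount_swap_mul_of_consecutive {k : Fin n} {w₀ w w' : Equiv.Perm (Fin n)}
    (h : w ∈ prefixClass k w₀) (h' : w' ∈ prefixClass k w₀) (hlt : w k < w' k)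
    (hcons : ∀ x ∈ prefixClass k w₀, w k < x k → ¬ x k < w' k) :
    invCount (Equiv.swap (w k) (w' k) * w) = invCount w + 1 := by
  obtain ⟨hD, hag⟩ := prefixClass_agree h h'
  obtain ⟨p, hp⟩ := w.surjective (w' k)
  obtain ⟨hkp, hpar, hDp⟩ := exchange_up hD hag hlt
  rw [← hp, show w⁻¹ (w p) = p from w.symm_apply_apply p] at hkp hpar hDp
  rw [← hp] at hlt hcons ⊢
  rw [← Equiv.mul_swap_eq_swap_mul]
  refine invCount_mul_swap_of_forall w hkp hlt fun q hkq hqp hlo hhi => ?_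
  have hc := clear_of_oddDiagram_mul_swap hkp hpar hDp
  have hq : (k : ℕ) % 2 = (q : ℕ) % 2 := by
    by_contra hne
    exact absurd (hc q (Ne.symm hne) hkq hlo).1 (not_lt.2 (Fin.le_def.1 hqp.le))
  have hDq : oddDiagram (w * Equiv.swap k q) = oddDiagram w := by
    refine oddDiagram_mul_swap_of_clear hkq hq hlo fun m hm hkm hlo' => ?_
    have := hc m hm hkm hlo'
    rw [Fin.lt_def] at hqp hhi
    omega
  refine hcons _ (mul_swap_mem_prefixClass h hkq hDq) ?_ ?_ <;>
    rwa [Equiv.Perm.mul_apply, Equiv.swap_apply_left]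

theorem sum_eq_mul_geom_sum {α R : Type*} [LinearOrder α] [CommSemiring R] (x : R) (f : α → R)
    (A : Finset α)
    (hstep : ∀ a ∈ A, ∀ a' ∈ A, a < a' → (∀ b ∈ A, a < b → ¬ b < a') → f a' = x * f a)
    {a₀ : α} (ha₀ : a₀ ∈ A) (hmin : ∀ b ∈ A, a₀ ≤ b) :
    ∃ m, ∑ a ∈ A, f a = f a₀ * ∑ i ∈ Finset.range (m + 1), x ^ i := by
  -- The induction adds a new maximum, so the value of `f` at the current maximum must be carried
  -- along.
  suffices h : ∃ m, (∑ a ∈ A, f a = f a₀ * ∑ i ∈ Finset.range (m + 1), x ^ i) ∧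
      ∀ a ∈ A, (∀ b ∈ A, b ≤ a) → f a = f a₀ * x ^ m from
    h.imp fun _ h => h.1
  induction A using Finset.induction_on_max with
  | empty => simp at ha₀
  | insert a s hs ih =>
    have has : a ∉ s := fun h => lt_irrefl _ (hs a h)
    have hmaxa : ∀ c ∈ insert a s, (∀ b ∈ insert a s, b ≤ c) → c = a := fun c hc hcm => by
      rcases Finset.mem_insert.1 hc with rfl | hc
      · rfl
      · exact absurd (hcm a (Finset.mem_insert_self _ _)) (not_le.2 (hs c hc))
    rw [Finset.sum_insert has]
    rcases s.eq_empty_or_nonempty with rfl | hne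
    · obtain rfl : a₀ = a := by simpa using ha₀
      refine ⟨0, by simp, fun c hc hcm => ?_⟩
      rw [hmaxa c hc hcm]; simp
    · have ha₀s : a₀ ∈ s := by
        rcases Finset.mem_insert.1 ha₀ with rfl | h
        · obtain ⟨b, hb⟩ := hne
          exact absurd (hmin b (Finset.mem_insert_of_mem hb)) (not_le.2 (hs b hb))
        · exact h
      obtain ⟨m, hm, hmax⟩ := ih (fun b hb c hc hbc hno =>
        hstep b (Finset.mem_insert_of_mem hb) c (Finset.mem_insert_of_mem hc) hbc fun d hd hbd => by
          rcases Finset.mem_insert.1 hd with rfl | hd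
          · exact (hs c hc).not_gt
          · exact hno d hd hbd) ha₀s fun b hb => hmin b (Finset.mem_insert_of_mem hb)
      have hfa : f a = f a₀ * x ^ (m + 1) := by
        have hM := s.max'_mem hne
        rw [hstep _ (Finset.mem_insert_of_mem hM) a (Finset.mem_insert_self _ _) (hs _ hM)
          fun d hd hMd => ?_, hmax _ hM fun b hb => s.le_max' b hb]
        · ring
        · rcases Finset.mem_insert.1 hd with rfl | hd
          · exact lt_irrefl _
          · exact absurd (s.le_max' d hd) (not_le.2 hMd)
      refine ⟨m + 1, ?_, fun c hc hcm => by rw [hmaxa c hc hcm, hfa]⟩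
      rw [hfa, hm, Finset.sum_range_succ _ (m + 1)]
      ring

/-- The fibre sums over the attained values at `k` form a geometric progression of ratio `X`
starting at the least value. -/
theorem exists_sum_prefixClass_eq {k : Fin n} {w₀ w₁ : Equiv.Perm (Fin n)}
    (h₁ : w₁ ∈ prefixClass k w₀) (hmin : ∀ w ∈ prefixClass k w₀, w₁ k ≤ w k) :
    ∃ m, ∑ w ∈ prefixClass k w₀, (X : ℤ[X]) ^ invCount w =
      (∑ w ∈ prefixClass (k + 1) w₁, (X : ℤ[X]) ^ invCount w) *
        ∑ i ∈ Finset.range (m + 1), X ^ i := by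
  classical
  set C := prefixClass k w₀ with hC
  have key := sum_eq_mul_geom_sum (X : ℤ[X])
    (fun a => ∑ w ∈ C.filter fun w => w k = a, X ^ invCount w)
    (C.image fun w => w k) ?_ (Finset.mem_image_of_mem _ h₁) ?_
  · rw [prefixClass_succ_eq h₁, ← Finset.sum_fiberwise_of_maps_to (t := C.image fun w => w k)
      (g := fun w => w k) fun w hw => Finset.mem_image_of_mem _ hw]
    exact key
  · intro a ha a' ha' hlt hcons
    obtain ⟨x, hx, rfl⟩ := Finset.mem_image.1 ha
    obtain ⟨y, hy, rfl⟩ := Finset.mem_image.1 ha'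
    symm
    rw [Finset.mul_sum]
    refine Finset.sum_nbij' (fun w => Equiv.swap (x k) (y k) * w)
      (fun w => Equiv.swap (x k) (y k) * w) ?_ ?_ ?_ ?_ ?_
    · intro w hw
      obtain ⟨hw, hwk⟩ := Finset.mem_filter.1 hw
      rw [← hwk] at hlt ⊢
      exact Finset.mem_filter.2 ⟨(exists_upSwap_of_lt hw hy hlt).2.1, by simp⟩
    · intro w hw
      obtain ⟨hw, hwk⟩ := Finset.mem_filter.1 hw
      rw [← hwk] at hlt ⊢
      exact Finset.mem_filter.2 ⟨(exists_upSwap_of_lt hx hw hlt).2.2.2, by simp⟩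
    · intro w _; rw [← mul_assoc, Equiv.swap_mul_self, one_mul]
    · intro w _; rw [← mul_assoc, Equiv.swap_mul_self, one_mul]
    · intro w hw
      obtain ⟨hw, hwk⟩ := Finset.mem_filter.1 hw
      rw [← hwk] at hlt hcons ⊢
      rw [invCount_swap_mul_of_consecutive hw hy hlt fun z hz =>
        hcons _ (Finset.mem_image_of_mem _ hz), pow_succ']
  · intro b hb
    obtain ⟨w, hw, rfl⟩ := Finset.mem_image.1 hb
    exact hmin w hw

theorem exists_least_prefixClass {k : ℕ} (hk : k ≤ n) (w₀ : Equiv.Perm (Fin n)) :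
    ∃ u ∈ prefixClass k w₀, (∀ w ∈ prefixClass k w₀, Relation.ReflTransGen UpSwap u w) ∧
      ∃ ms : Multiset ℕ, ∑ w ∈ prefixClass k w₀, (X : ℤ[X]) ^ invCount w =
        X ^ invCount u * (ms.map fun m => ∑ i ∈ Finset.range (m + 1), (X : ℤ[X]) ^ i).prod := by
  induction hk using Nat.decreasingInduction generalizing w₀ with
  | self =>
    refine ⟨w₀, self_mem_prefixClass _ _, by simp [prefixClass_eq_singleton]; rfl, 0, ?_⟩
    simp [prefixClass_eq_singleton]
  | of_succ k hk ih =>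
    obtain ⟨w₁, h₁, hmin⟩ := Finset.exists_min_image (prefixClass k w₀) (fun w => w ⟨k, hk⟩)
      ⟨w₀, self_mem_prefixClass _ _⟩
    obtain ⟨u, hu, humin, ms, hms⟩ := ih w₁
    obtain ⟨m, hm⟩ := exists_sum_prefixClass_eq (k := ⟨k, hk⟩) h₁ hmin
    dsimp only at hm
    rw [hms] at hm
    rw [prefixClass_succ_eq (k := ⟨k, hk⟩) h₁] at hu humin
    refine ⟨u, (Finset.mem_filter.1 hu).1, fun w hw => ?_, m ::ₘ ms, ?_⟩
    · rcases (hmin w hw).eq_or_lt with he | hlt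
      · exact humin w (Finset.mem_filter.2 ⟨hw, he.symm⟩)
      · obtain ⟨-, -, hs, hm⟩ := exists_upSwap_of_lt (k := ⟨k, hk⟩) h₁ hw hlt
        exact Relation.ReflTransGen.tail (humin _ (Finset.mem_filter.2 ⟨hm, by simp⟩)) hs
    · rw [hm, Multiset.map_cons, Multiset.prod_cons]
      ring

/-! ### Independence of exchanges in the two parities. -/

theorem clear_mul_swap_iff {w : Equiv.Perm (Fin n)} {i j : Fin n} {a b lo hi : ℕ}
    (hi' : (i : ℕ) % 2 = a % 2) (hj' : (j : ℕ) % 2 = a % 2) :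
    Clear a b lo hi (w * Equiv.swap i j) ↔ Clear a b lo hi w := by
  refine forall_congr' fun q => imp_congr_right fun hq => ?_
  rw [Equiv.Perm.mul_apply, Equiv.swap_apply_of_ne_of_ne]
  · rintro rfl; exact hq hi'
  · rintro rfl; exact hq hj'

theorem oddDiagram_mul_swap_iff_min_max {w : Equiv.Perm (Fin n)} {i j : Fin n} (hij : i < j)
    (hpar : (i : ℕ) % 2 = (j : ℕ) % 2) :
    oddDiagram (w * Equiv.swap i j) = oddDiagram w ↔
      Clear i j (min (w i : ℕ) (w j)) (max (w i : ℕ) (w j)) w := by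
  rcases lt_trichotomy (w i) (w j) with h | h | h
  · rw [min_eq_left (Fin.le_def.1 h.le), max_eq_right (Fin.le_def.1 h.le)]
    exact oddDiagram_mul_swap_iff hij hpar h
  · exact absurd (w.injective h) hij.ne
  · rw [min_eq_right (Fin.le_def.1 h.le), max_eq_left (Fin.le_def.1 h.le)]
    have key := oddDiagram_mul_swap_iff (w := w * Equiv.swap i j) hij hpar (by simpa using h)
    rw [mul_assoc, Equiv.swap_mul_self, mul_one, clear_mul_swap_iff rfl hpar.symm] at key
    rw [eq_comm, key]
    simp

/-- Clearance of both rectangles is needed: it rules out the crossing positions in which an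
exchanged corner of one would enter the region forbidden by the other. -/
theorem clear_mul_swap {w : Equiv.Perm (Fin n)} {i j i' j' : Fin n} (hij : i < j) (hij' : i' < j')
    (hpar : (i : ℕ) % 2 = (j : ℕ) % 2) (hpar' : (i' : ℕ) % 2 = (j' : ℕ) % 2)
    (hopp : (i : ℕ) % 2 ≠ (i' : ℕ) % 2)
    (h : Clear i j (min (w i : ℕ) (w j)) (max (w i : ℕ) (w j)) w)
    (h' : Clear i' j' (min (w i' : ℕ) (w j')) (max (w i' : ℕ) (w j')) w) :
    Clear i j (min (w i : ℕ) (w j)) (max (w i : ℕ) (w j)) (w * Equiv.swap i' j') := by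
  have hne : ∀ {a b : Fin n}, (a : ℕ) ≠ b → (w a : ℕ) ≠ w b := fun hab e =>
    hab (congrArg Fin.val (w.injective (Fin.ext e)))
  have e1 := hne (a := i) (b := i') (by omega)
  have e2 := hne (a := i) (b := j') (by omega)
  have e3 := hne (a := j) (b := i') (by omega)
  have e4 := hne (a := j) (b := j') (by omega)
  have a1 := h i'
  have a2 := h j'
  have b1 := h' i
  have b2 := h' j
  intro q hq
  rw [Equiv.Perm.mul_apply, Equiv.swap_apply_def]
  rw [Fin.lt_def] at hij hij'
  split_ifs with h1 h2
  · subst h1; omega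
  · subst h2; omega
  · exact h q hq

/-- An exchange of the values at two positions of the parity of `c` preserving the odd diagram. -/
def ClassSwap (c : ℕ) (w w' : Equiv.Perm (Fin n)) : Prop :=
  oddDiagram w' = oddDiagram w ∧ ∃ i j : Fin n, i < j ∧ (i : ℕ) % 2 = c % 2 ∧ (j : ℕ) % 2 = c % 2 ∧
    w' = w * Equiv.swap i j

theorem ClassSwap.symm {c : ℕ} {w w' : Equiv.Perm (Fin n)} (h : ClassSwap c w w') :
    ClassSwap c w' w := by
  obtain ⟨hD, i, j, hij, hi, hj, rfl⟩ := h
  exact ⟨hD.symm, i, j, hij, hi, hj, by rw [mul_assoc, Equiv.swap_mul_self, mul_one]⟩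

theorem UpSwap.classSwap {w w' : Equiv.Perm (Fin n)} (h : UpSwap w w') (c : ℕ) :
    ClassSwap c w w' ∨ ClassSwap (c + 1) w w' := by
  obtain ⟨hD, i, j, hij, hpar, -, rfl⟩ := h
  rcases Nat.mod_two_eq_zero_or_one (i + c) with h | h
  · exact Or.inl ⟨hD, i, j, hij, by omega, by omega, rfl⟩
  · exact Or.inr ⟨hD, i, j, hij, by omega, by omega, rfl⟩

theorem ClassSwap.exchange {c : ℕ} {w w₁ w₂ : Equiv.Perm (Fin n)} (h : ClassSwap c w w₁)
    (h' : ClassSwap (c + 1) w₁ w₂) :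
    ∃ w₁', ClassSwap (c + 1) w w₁' ∧ ClassSwap c w₁' w₂ := by
  obtain ⟨hD, i, j, hij, hi, hj, rfl⟩ := h
  obtain ⟨hD', i', j', hij', hi', hj', rfl⟩ := h'
  have hcomm : Equiv.swap i j * Equiv.swap i' j' = Equiv.swap i' j' * Equiv.swap i j := by
    rw [Equiv.mul_swap_eq_swap_mul, Equiv.swap_apply_of_ne_of_ne, Equiv.swap_apply_of_ne_of_ne] <;>
      (rintro rfl; omega)
  have c1 := (oddDiagram_mul_swap_iff_min_max (w := w * Equiv.swap i j) hij (hi.trans hj.symm)).1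
    (by rw [mul_assoc, Equiv.swap_mul_self, mul_one, hD])
  have c2 := (oddDiagram_mul_swap_iff_min_max hij' (hi'.trans hj'.symm)).1 hD'
  have c3 := clear_mul_swap hij hij' (hi.trans hj.symm) (hi'.trans hj'.symm) (by omega) c1 c2
  have e : ∀ q : Fin n, (q : ℕ) % 2 = c % 2 →
      (w * Equiv.swap i j * Equiv.swap i' j') q = (w * Equiv.swap i j) q := fun q hq => by
    rw [Equiv.Perm.mul_apply, Equiv.swap_apply_of_ne_of_ne] <;> (rintro rfl; omega)
  rw [← e i hi, ← e j hj, ← oddDiagram_mul_swap_iff_min_max hij (hi.trans hj.symm)] at c3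
  have e2 : w * Equiv.swap i j * Equiv.swap i' j' * Equiv.swap i j = w * Equiv.swap i' j' := by
    rw [mul_assoc w, hcomm, ← mul_assoc, mul_assoc, Equiv.swap_mul_self, mul_one]
  rw [e2] at c3
  refine ⟨w * Equiv.swap i' j', ⟨c3.trans (hD'.trans hD), i', j', hij', hi', hj', rfl⟩,
    c3.symm, i, j, hij, hi, hj, ?_⟩
  rw [mul_assoc, hcomm, mul_assoc]

/-- By `ClassSwap.exchange`, each exchange of parity `c + 1` can be pushed in front of those of
parity `c`. -/
theorem exists_sorted_path {c : ℕ} {w w' : Equiv.Perm (Fin n)}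
    (h : Relation.ReflTransGen (fun a b => ClassSwap c a b ∨ ClassSwap (c + 1) a b) w w') :
    ∃ m, Relation.ReflTransGen (ClassSwap (c + 1)) w m ∧
      Relation.ReflTransGen (ClassSwap c) m w' := by
  have push : ∀ {m a b : Equiv.Perm (Fin n)}, Relation.ReflTransGen (ClassSwap c) m a →
      ClassSwap (c + 1) a b →
      ∃ m', ClassSwap (c + 1) m m' ∧ Relation.ReflTransGen (ClassSwap c) m' b := by
    intro m a b hma hab
    induction hma generalizing b with
    | refl => exact ⟨b, hab, .refl⟩
    | tail _ hs ih =>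
      obtain ⟨y, h1, h2⟩ := hs.exchange hab
      obtain ⟨m', h3, h4⟩ := ih h1
      exact ⟨m', h3, h4.tail h2⟩
  induction h with
  | refl => exact ⟨w, .refl, .refl⟩
  | tail _ hs ih =>
    obtain ⟨m, h1, h2⟩ := ih
    rcases hs with hs | hs
    · exact ⟨m, h1, h2.tail hs⟩
    · obtain ⟨m', h3, h4⟩ := push h2 hs
      exact ⟨m', h1.tail h3, h4⟩

theorem reflTransGen_classSwap {w w' : Equiv.Perm (Fin n)} (hD : oddDiagram w' = oddDiagram w)
    (c : ℕ) :
    Relation.ReflTransGen (fun a b => ClassSwap c a b ∨ ClassSwap (c + 1) a b) w w' := by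
  obtain ⟨u, -, hu, -⟩ := exists_least_prefixClass (Nat.zero_le n) w
  have hmem : ∀ x, oddDiagram x = oddDiagram w → x ∈ prefixClass 0 w := fun x hx =>
    mem_prefixClass.2 ⟨hx, fun _ h => absurd h (Nat.not_lt_zero _)⟩
  have hsymm : Std.Symm fun a b : Equiv.Perm (Fin n) => ClassSwap c a b ∨ ClassSwap (c + 1) a b :=
    ⟨fun a b h => h.imp ClassSwap.symm ClassSwap.symm⟩
  have hup : ∀ x, oddDiagram x = oddDiagram w →
      Relation.ReflTransGen (fun a b => ClassSwap c a b ∨ ClassSwap (c + 1) a b) u x :=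
    fun x hx => (hu x (hmem x hx)).lift id fun a b h => h.classSwap c
  exact (Relation.ReflTransGen.stdSymm.symm _ _ (hup w rfl)).trans (hup w' hD)

/-- On a sorted path from `w` to `w'`, the exchanges of the other parity come first; they fix the
entries at `i` and `j` and keep clearance by `clear_mul_swap`. Those of the parity of `i` move no
entry that clearance tests. -/
theorem clear_of_oddDiagram_eq {w w' : Equiv.Perm (Fin n)} (hD : oddDiagram w' = oddDiagram w)
    {i j : Fin n} (hij : i < j) (hpar : (i : ℕ) % 2 = (j : ℕ) % 2)
    (hs : oddDiagram (w * Equiv.swap i j) = oddDiagram w) :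
    Clear i j (min (w i : ℕ) (w j)) (max (w i : ℕ) (w j)) w' := by
  obtain ⟨m, hm, hm'⟩ := exists_sorted_path (reflTransGen_classSwap hD i)
  have hclear : Clear i j (min (w i : ℕ) (w j)) (max (w i : ℕ) (w j)) m ∧
      m i = w i ∧ m j = w j := by
    clear hm'
    induction hm with
    | refl => exact ⟨(oddDiagram_mul_swap_iff_min_max hij hpar).1 hs, rfl, rfl⟩
    | tail _ hst ih =>
      obtain ⟨ihc, ihi, ihj⟩ := ih
      obtain ⟨hD', i', j', hij', hi', hj', rfl⟩ := hst
      rw [← ihi, ← ihj] at ihc ⊢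
      refine ⟨clear_mul_swap hij hij' hpar (hi'.trans hj'.symm) (by omega) ihc
        ((oddDiagram_mul_swap_iff_min_max hij' (hi'.trans hj'.symm)).1 hD'), ?_, ?_⟩ <;>
      · rw [Equiv.Perm.mul_apply, Equiv.swap_apply_of_ne_of_ne] <;> (rintro rfl; omega)
  replace hclear := hclear.1
  clear hm hD
  induction hm' with
  | refl => exact hclear
  | tail _ hst ih =>
    obtain ⟨-, i', j', -, hi', hj', rfl⟩ := hst
    exact (clear_mul_swap_iff hi' hj').2 ih

/-! ### Swap boxes, and why the Bruhat interval stays in the class. -/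

/-- `[i, j] × [lo, hi]` is spanned by two points of some permutation with odd diagram `D` which
can be exchanged without changing `D`. -/
def IsSwapBox (D : Set (Fin n × Fin n)) (i j lo hi : Fin n) : Prop :=
  i < j ∧ (i : ℕ) % 2 = (j : ℕ) % 2 ∧ lo < hi ∧ ∃ w : Equiv.Perm (Fin n),
    w i = lo ∧ w j = hi ∧ oddDiagram w = D ∧ oddDiagram (w * Equiv.swap i j) = D

theorem IsSwapBox.clear {D : Set (Fin n × Fin n)} {i j lo hi : Fin n} (h : IsSwapBox D i j lo hi)
    {w : Equiv.Perm (Fin n)} (hw : oddDiagram w = D) : Clear i j lo hi w := by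
  obtain ⟨hij, hpar, hlt, x, rfl, rfl, hx, hxs⟩ := h
  have := clear_of_oddDiagram_eq (hw.trans hx.symm) hij hpar (hxs.trans hx.symm)
  rwa [min_eq_left (Fin.le_def.1 hlt.le), max_eq_right (Fin.le_def.1 hlt.le)] at this

/-- All four corners of the second box are points of a member, before or after its exchange, so the
first box is clear of each. -/
theorem IsSwapBox.clear_box {D : Set (Fin n × Fin n)} {i j lo hi i' j' lo' hi' : Fin n}
    (h : IsSwapBox D i j lo hi) (h' : IsSwapBox D i' j' lo' hi')
    (hopp : (i : ℕ) % 2 ≠ (i' : ℕ) % 2) :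
    (i < i' → lo < lo' → j < i' ∧ hi < lo') ∧ (i < i' → lo < hi' → j < i' ∧ hi < hi') ∧
      (i < j' → lo < lo' → j < j' ∧ hi < lo') ∧ (i < j' → lo < hi' → j < j' ∧ hi < hi') := by
  obtain ⟨-, hpar', -, x, rfl, rfl, hx, hxs⟩ := h'
  have h1 := h.clear hx
  have h2 := h.clear hxs
  have a1 := h2 i' hopp.symm
  have a2 := h2 j' (by omega)
  rw [Equiv.Perm.mul_apply, Equiv.swap_apply_left] at a1
  rw [Equiv.Perm.mul_apply, Equiv.swap_apply_right] at a2
  exact ⟨h1 i' hopp.symm, a1, a2, h1 j' (by omega)⟩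

theorem IsSwapBox.inv_mod_two {D : Set (Fin n × Fin n)} {i j lo hi : Fin n}
    (h : IsSwapBox D i j lo hi) {w : Equiv.Perm (Fin n)} (hw : oddDiagram w = D) :
    (w⁻¹ lo : ℕ) % 2 = i % 2 ∧ (w⁻¹ hi : ℕ) % 2 = i % 2 := by
  obtain ⟨-, hpar, -, x, rfl, rfl, hx, -⟩ := h
  have h1 := inv_mod_two_eq (hx.trans hw.symm) (x i)
  have h2 := inv_mod_two_eq (hx.trans hw.symm) (x j)
  rw [show x⁻¹ (x i) = i from x.symm_apply_apply i] at h1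
  rw [show x⁻¹ (x j) = j from x.symm_apply_apply j] at h2
  omega

theorem rankCount_eq_of_not_mem_swapBox {u v : Equiv.Perm (Fin n)}
    (huv : Relation.ReflTransGen UpSwap u v) {k b : ℕ}
    (hno : ∀ i j lo hi, IsSwapBox (oddDiagram u) i j lo hi →
      ¬ ((i : ℕ) < k ∧ k ≤ j ∧ (lo : ℕ) < b ∧ b ≤ hi)) :
    rankCount v k b = rankCount u k b ∧ oddDiagram v = oddDiagram u := by
  induction huv with
  | refl => exact ⟨rfl, rfl⟩
  | tail _ hs ih =>
    obtain ⟨hD, i, j, hij, hpar, hlt, rfl⟩ := hs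
    refine ⟨?_, hD.trans ih.2⟩
    rw [rankCount_mul_swap _ hij hlt, ih.1,
      if_neg (hno i j _ _ ⟨hij, hpar, hlt, _, rfl, rfl, ih.2, hD.trans ih.2⟩), add_zero]

theorem le_apply_iff_of_rankCount {u x : Equiv.Perm (Fin n)} {k : Fin n} {b : ℕ}
    (h : rankCount x k b = rankCount u k b) (h' : rankCount x (k + 1) b = rankCount u (k + 1) b) :
    b ≤ x k ↔ b ≤ u k := by
  rw [rankCount_succ_left, rankCount_succ_left] at h'
  split_ifs at h' <;> omega

theorem inv_lt_iff_of_rankCount {u x : Equiv.Perm (Fin n)} {k : ℕ} {b : Fin n}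
    (h : rankCount x k b = rankCount u k b) (h' : rankCount x k (b + 1) = rankCount u k (b + 1)) :
    (x⁻¹ b : ℕ) < k ↔ (u⁻¹ b : ℕ) < k := by
  rw [rankCount_succ_right, rankCount_succ_right] at h
  split_ifs at h <;> omega

theorem exists_minimal_nat {P : ℕ → Prop} (h : ∃ m, P m) : ∃ m, P m ∧ ∀ l, P l → m ≤ l := by
  classical
  exact ⟨Nat.find h, Nat.find_spec h, fun _ => Nat.find_min' h⟩

/-- Rank counts at adjacent places off all swap boxes decide on which side of a level the entry at
`k` lies, or on which side of a position the value `b` lies. If swap boxes cover `(k, b)`, an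
extremal one provides such places at its border. -/
theorem apply_ne_and_box_iff {u x : Equiv.Perm (Fin n)}
    (hr : ∀ k b : ℕ, (∀ i j lo hi, IsSwapBox (oddDiagram u) i j lo hi →
      ¬ ((i : ℕ) < k ∧ k ≤ j ∧ (lo : ℕ) < b ∧ b ≤ hi)) → rankCount x k b = rankCount u k b)
    {k b : Fin n} (hkb : (k : ℕ) % 2 ≠ (u⁻¹ b : ℕ) % 2) :
    x k ≠ b ∧ (b < x k ∧ k < x⁻¹ b ↔ b < u k ∧ k < u⁻¹ b) := by
  have hxk : x k = b ↔ x⁻¹ b = k := by rw [Equiv.Perm.inv_eq_iff_eq, eq_comm]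
  have huk : u k = b ↔ u⁻¹ b = k := by rw [Equiv.Perm.inv_eq_iff_eq, eq_comm]
  simp only [Fin.lt_def, Fin.ext_iff, ne_eq] at hxk huk ⊢
  have color : ∀ {i j lo hi}, IsSwapBox (oddDiagram u) i j lo hi →
      (i : ℕ) % 2 ≠ (u⁻¹ b : ℕ) % 2 → (lo : ℕ) ≠ b ∧ (hi : ℕ) ≠ b := fun h hi => by
    have := h.inv_mod_two rfl
    refine ⟨fun e => ?_, fun e => ?_⟩
    · rw [Fin.ext e] at this; omega
    · rw [Fin.ext e] at this; omega
  -- Boxes of the parity of `u⁻¹ b` spanning position `k` and starting no higher than `b`. For the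
  -- lowest one, level `lo` at `k` is off all boxes; clearance gives `u k < lo`, hence `x k < lo ≤
  -- b`.
  by_cases hA : ∃ L : ℕ, ∃ i j lo hi, IsSwapBox (oddDiagram u) i j lo hi ∧ (lo : ℕ) = L ∧
      (i : ℕ) % 2 ≠ (k : ℕ) % 2 ∧ i < k ∧ k < j ∧ lo ≤ b
  · obtain ⟨_, ⟨i, j, lo, hi, hbox, rfl, hik, h1, h2, h3⟩, hmin⟩ := exists_minimal_nat hA
    have hcov : ∀ i' j' lo' hi', IsSwapBox (oddDiagram u) i' j' lo' hi' →
        ¬ ((i' : ℕ) ≤ k ∧ (k : ℕ) ≤ j' ∧ (lo' : ℕ) < lo ∧ (lo : ℕ) ≤ hi') := by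
      rintro i' j' lo' hi' hbox' ⟨c1, c2, c3, c4⟩
      rw [Fin.lt_def] at h1 h2
      rw [Fin.le_def] at h3
      have hp' := hbox'.2.1
      by_cases hpar : (i' : ℕ) % 2 = (k : ℕ) % 2
      · have hne : (lo : ℕ) ≠ hi' := fun e => by
          have q1 := hbox.inv_mod_two rfl
          have q2 := hbox'.inv_mod_two rfl
          rw [Fin.ext e] at q1
          omega
        have d1 := hbox.clear_box hbox' (by omega)
        have d2 := hbox'.clear_box hbox (by omega)
        have := hbox.1
        have := hbox'.1
        simp only [Fin.lt_def] at d1 d2 this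
        omega
      · have := hmin lo' ⟨i', j', lo', hi', hbox', rfl, hpar, Fin.lt_def.2 (by omega),
          Fin.lt_def.2 (by omega), Fin.le_def.2 (by omega)⟩
        omega
    have hx := le_apply_iff_of_rankCount
      (hr k lo fun i' j' lo' hi' hb hc => hcov i' j' lo' hi' hb (by omega))
      (hr (k + 1) lo fun i' j' lo' hi' hb hc => hcov i' j' lo' hi' hb (by omega))
    have hu := hbox.clear (w := u) rfl k hik.symm h1
    rw [Fin.lt_def] at h2
    rw [Fin.le_def] at h3
    have hne : (u k : ℕ) ≠ lo := fun e => by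
      have q1 := (hbox.inv_mod_two (w := u) rfl).1
      rw [← Fin.ext e, show u⁻¹ (u k) = k from u.symm_apply_apply k] at q1
      omega
    omega
  -- Boxes of the parity of `k` spanning level `b` and starting no later than `k`. For the leftmost
  -- one, clearance puts `b` before position `i` in `u`, and the rank counts at `i` put it there in
  -- `x`.
  by_cases hB : ∃ M : ℕ, ∃ i j lo hi, IsSwapBox (oddDiagram u) i j lo hi ∧ (i : ℕ) = M ∧
      (i : ℕ) % 2 = (k : ℕ) % 2 ∧ lo < b ∧ b < hi ∧ i ≤ k
  · obtain ⟨_, ⟨i, j, lo, hi, hbox, rfl, hik, h1, h2, h3⟩, hmin⟩ := exists_minimal_nat hB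
    have hcov : ∀ i' j' lo' hi', IsSwapBox (oddDiagram u) i' j' lo' hi' →
        ¬ ((i' : ℕ) < i ∧ (i : ℕ) ≤ j' ∧ (lo' : ℕ) ≤ b ∧ (b : ℕ) ≤ hi') := by
      rintro i' j' lo' hi' hbox' ⟨c1, c2, c3, c4⟩
      rw [Fin.lt_def] at h1 h2
      rw [Fin.le_def] at h3
      have hp' := hbox'.2.1
      by_cases hpar : (i' : ℕ) % 2 = (k : ℕ) % 2
      · have hne := color hbox' (by omega)
        have := hmin i' ⟨i', j', lo', hi', hbox', rfl, hpar, Fin.lt_def.2 (by omega),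
          Fin.lt_def.2 (by omega), Fin.le_def.2 (by omega)⟩
        omega
      · have d2 := hbox'.clear_box hbox (by omega)
        simp only [Fin.lt_def] at d2
        omega
    have hx := inv_lt_iff_of_rankCount
      (hr i b fun i' j' lo' hi' hb hc => hcov i' j' lo' hi' hb (by omega))
      (hr i (b + 1) fun i' j' lo' hi' hb hc => hcov i' j' lo' hi' hb (by omega))
    have hu := hbox.clear (w := u) rfl (u⁻¹ b) (by omega)
    rw [show u (u⁻¹ b) = b from u.apply_symm_apply b] at hu
    rw [Fin.lt_def] at h1 h2
    rw [Fin.le_def] at h3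
    omega
  -- Parity excludes the borders, so no box contains `(k, b)` and the rank counts at all four
  -- corners of this cell are forced.
  have hcov : ∀ i j lo hi, IsSwapBox (oddDiagram u) i j lo hi →
      ¬ ((i : ℕ) ≤ k ∧ (k : ℕ) ≤ j ∧ (lo : ℕ) ≤ b ∧ (b : ℕ) ≤ hi) := by
    rintro i j lo hi hbox ⟨c1, c2, c3, c4⟩
    have hp := hbox.2.1
    by_cases hpar : (i : ℕ) % 2 = (k : ℕ) % 2
    · have hne := color hbox (by omega)
      exact hB ⟨i, i, j, lo, hi, hbox, rfl, hpar, Fin.lt_def.2 (by omega),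
        Fin.lt_def.2 (by omega), Fin.le_def.2 c1⟩
    · exact hA ⟨lo, i, j, lo, hi, hbox, rfl, hpar, Fin.lt_def.2 (by omega),
        Fin.lt_def.2 (by omega), Fin.le_def.2 c3⟩
  have r1 := hr k b fun i j lo hi hb hc => hcov i j lo hi hb (by omega)
  have r2 := hr (k + 1) b fun i j lo hi hb hc => hcov i j lo hi hb (by omega)
  have r3 := hr k (b + 1) fun i j lo hi hb hc => hcov i j lo hi hb (by omega)
  have r4 := hr (k + 1) (b + 1) fun i j lo hi hb hc => hcov i j lo hi hb (by omega)
  have s1 := le_apply_iff_of_rankCount r1 r2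
  have s2 := le_apply_iff_of_rankCount r3 r4
  have s3 := inv_lt_iff_of_rankCount r1 r3
  have s4 := inv_lt_iff_of_rankCount r2 r4
  have : (k : ℕ) ≠ (u⁻¹ b : ℕ) := fun e => hkb (by rw [e])
  omega

theorem oddDiagram_eq_of_mem_bruhatInterval {u v x : Equiv.Perm (Fin n)}
    (huv : Relation.ReflTransGen UpSwap u v) (hx : x ∈ bruhatInterval u v) :
    oddDiagram x = oddDiagram u := by
  have key : ∀ {k b : Fin n}, (k : ℕ) % 2 ≠ (u⁻¹ b : ℕ) % 2 →
      x k ≠ b ∧ (b < x k ∧ k < x⁻¹ b ↔ b < u k ∧ k < u⁻¹ b) := apply_ne_and_box_iff fun k b hno => by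
    have h1 := hx.1.rankCount_le k b
    have h2 := hx.2.rankCount_le k b
    have h3 := (rankCount_eq_of_not_mem_swapBox huv hno).1
    omega
  have hcolor : ∀ b, (x⁻¹ b : ℕ) % 2 = (u⁻¹ b : ℕ) % 2 := fun b => by
    by_contra hne
    exact (key hne).1 (x.apply_symm_apply b)
  ext ⟨k, b⟩
  rw [mem_oddDiagram, mem_oddDiagram, ← and_assoc, ← and_assoc, hcolor]
  exact and_congr_left fun h => (key h).2

theorem exists_permClass_eq_bruhatInterval (w₀ : Equiv.Perm (Fin n)) :
    ∃ u v : Equiv.Perm (Fin n), BruhatLE u v ∧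
      permClass (oddDiagram w₀) = bruhatInterval u v ∧
      ∃ ms : Multiset ℕ, poincare u v =
        (ms.map fun m => ∑ i ∈ Finset.range (m + 1), (X : ℤ[X]) ^ i).prod := by
  classical
  obtain ⟨u, hu, humin, ms, hms⟩ := exists_least_prefixClass (Nat.zero_le n) w₀
  obtain ⟨v, hv, hvmax⟩ := exists_greatest_prefixClass (Nat.zero_le n) w₀
  have hmem : ∀ {x}, x ∈ prefixClass 0 w₀ ↔ oddDiagram x = oddDiagram w₀ := fun {x} =>
    mem_prefixClass.trans (and_iff_left fun _ h => absurd h (Nat.not_lt_zero _))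
  have hle : ∀ {a b : Equiv.Perm (Fin n)}, Relation.ReflTransGen UpSwap a b → BruhatLE a b :=
    fun h => h.lift id fun _ _ => UpSwap.bruhatStep
  have hset : permClass (oddDiagram w₀) = bruhatInterval u v := by
    ext x
    refine ⟨fun hx => ⟨hle (humin x (hmem.2 hx)), hle (hvmax x (hmem.2 hx))⟩, fun hx => ?_⟩
    exact (oddDiagram_eq_of_mem_bruhatInterval (humin v hv) hx).trans (hmem.1 hu)
  refine ⟨u, v, hle (humin v hv), hset, ms, ?_⟩
  -- Multiplying by `X ^ invCount u` removes the subtraction in the exponents of `poincare`.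
  refine mul_left_cancel₀ (pow_ne_zero (invCount u) (X_ne_zero (R := ℤ))) ?_
  rw [← hms, poincare, Finset.mul_sum]
  refine Finset.sum_congr ?_ fun w hw => ?_
  · ext w
    rw [Finset.mem_filter, ← hset, hmem]
    simp [permClass]
  · have hwu : invCount u ≤ invCount w := by
      simpa only [length_eq_invCount] using (hle (humin w hw)).length_le
    rw [length_eq_invCount, length_eq_invCount, ← pow_add, Nat.add_sub_cancel' hwu]

/-! ### Palindromicity and rank symmetry. -/

theorem coeff_geom_sum (m k : ℕ) :
    (∑ i ∈ Finset.range (m + 1), (X : ℤ[X]) ^ i).coeff k = if k ≤ m then 1 else 0 := by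
  simp [coeff_X_pow]

theorem natDegree_geom_sum (m : ℕ) :
    (∑ i ∈ Finset.range (m + 1), (X : ℤ[X]) ^ i).natDegree = m := by
  refine le_antisymm (natDegree_le_iff_coeff_eq_zero.2 fun k hk => ?_)
    (le_natDegree_of_ne_zero ?_)
  · rw [coeff_geom_sum, if_neg (by omega)]
  · rw [coeff_geom_sum, if_pos le_rfl]; exact one_ne_zero

theorem isPalindromic_geom_sum (m : ℕ) :
    IsPalindromic (∑ i ∈ Finset.range (m + 1), (X : ℤ[X]) ^ i) := by
  ext k
  rw [coeff_reverse, natDegree_geom_sum, coeff_geom_sum, coeff_geom_sum]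
  rcases le_or_gt k m with h | h
  · rw [revAt_le h, if_pos h, if_pos (by omega)]
  · rw [revAt_eq_self_of_lt h]

theorem isPalindromic_prod_geom_sum (ms : Multiset ℕ) :
    IsPalindromic (ms.map fun m => ∑ i ∈ Finset.range (m + 1), (X : ℤ[X]) ^ i).prod := by
  induction ms using Multiset.induction_on with
  | empty => simpa [IsPalindromic] using reverse_C (1 : ℤ)
  | cons m ms ih =>
    rw [Multiset.map_cons, Multiset.prod_cons, IsPalindromic, reverse_mul_of_domain,
      isPalindromic_geom_sum, ih]

theorem coeff_poincare (u v : Equiv.Perm (Fin n)) (k : ℕ) :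
    (poincare u v).coeff k = {w ∈ bruhatInterval u v | length w = length u + k}.ncard := by
  classical
  rw [poincare, finsetSum_coeff]
  simp only [coeff_X_pow]
  rw [Finset.sum_boole, Finset.filter_filter, ← Set.ncard_coe_finset]
  congr 2
  ext w
  simp only [Finset.coe_filter, Finset.mem_univ, true_and, Set.mem_ofPred_eq]
  refine and_congr_right fun hw => ?_
  have := hw.1.length_le
  omega

theorem natDegree_poincare {u v : Equiv.Perm (Fin n)} (huv : BruhatLE u v) :
    (poincare u v).natDegree = length v - length u := by
  have hle := huv.length_le
  refine le_antisymm (natDegree_le_iff_coeff_eq_zero.2 fun k hk => ?_)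
    (le_natDegree_of_ne_zero ?_)
  · rw [coeff_poincare, Nat.cast_eq_zero, Set.ncard_eq_zero, Set.eq_empty_iff_forall_notMem]
    rintro w ⟨hw, hl⟩
    have := hw.2.length_le
    omega
  · rw [coeff_poincare, Nat.cast_ne_zero]
    exact Set.ncard_ne_zero_of_mem (a := v) ⟨⟨huv, .refl⟩, by omega⟩

theorem IsPalindromic.isRankSymmetric {u v : Equiv.Perm (Fin n)} (huv : BruhatLE u v)
    (h : IsPalindromic (poincare u v)) : IsRankSymmetric u v := by
  intro k
  have hle := huv.length_le
  rcases le_or_gt k (length v - length u) with hk | hk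
  · have hc := congrArg (fun f => f.coeff k) h
    simp only [coeff_reverse, natDegree_poincare huv, revAt_le hk, coeff_poincare,
      Nat.cast_inj] at hc
    rw [← hc]
    congr 1
    ext w
    simp only [Set.mem_ofPred_eq]
    refine and_congr_right fun _ => ?_
    omega
  -- Beyond the degree `reverse` gives no information, but both ranks are empty.
  · have h1 : {w ∈ bruhatInterval u v | length w = length u + k} = ∅ := by
      refine Set.eq_empty_iff_forall_notMem.2 ?_
      rintro w ⟨hw, hl⟩
      have := hw.2.length_le
      omega
    have h2 : {w ∈ bruhatInterval u v | length w + k = length v} = ∅ := by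
      refine Set.eq_empty_iff_forall_notMem.2 ?_
      rintro w ⟨hw, hl⟩
      have := hw.1.length_le
      omega
    rw [h1, h2]

end OddDiagram

theorem theorem1p2 (n : ℕ) (D : Set (Fin n × Fin n)) (hD : OddDiagram.IsOddDiagram D) :
    ∃ u v : Equiv.Perm (Fin n),
      OddDiagram.BruhatLE u v ∧
      OddDiagram.permClass D = OddDiagram.bruhatInterval u v ∧
      (∃ ms : Multiset ℕ, OddDiagram.poincare u v =
        (ms.map fun m => ∑ i ∈ Finset.range (m + 1), (Polynomial.X : Polynomial ℤ) ^ i).prod) ∧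
      OddDiagram.IsPalindromic (OddDiagram.poincare u v) ∧
      OddDiagram.IsRankSymmetric u v := by
  obtain ⟨w₀, rfl⟩ := hD
  obtain ⟨u, v, huv, hset, ms, hms⟩ := OddDiagram.exists_permClass_eq_bruhatInterval w₀
  have hpal : OddDiagram.IsPalindromic (OddDiagram.poincare u v) :=
    hms ▸ OddDiagram.isPalindromic_prod_geom_sum ms
  exact ⟨u, v, huv, hset, ⟨ms, hms⟩, hpal, hpal.isRankSymmetric huv⟩
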